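/- Let $F$ be a field and let $\mathrm{Zar}(F)$ be the set of all valuation rings of $F$ (subrings $V$ of $F$ with $t\in V$ or $t^{-1}\in V$ for every $0\neq t\in F$; $V=F$ is allowed). The patch topology on $\mathrm{Zar}(F)$ is the topology having as a basis the sets $\{V : x_1,\dots,x_n\in V,\ y_1,\dots,y_m\notin V\}$ with $n,m\ge 0$ and $x_i,y_j\in F$; for $X\subseteq\mathrm{Zar}(F)$, $\lim(X)$ denotes the set of limit points of $X$ in the patch topology. Write $A(X)=\bigcap_{V\in X}V$ (with $A(\emptyset)=F$) and, for $X\neq\emptyset$, $J(X)=\bigcap_{V\in X}\mathfrak M_V$, where $\mathfrak M_V$ is the maximal ideal of $V$. A valuation ring has rank one if its Krull dimension is $1$. A Prüfer domain is an integral domain whose localization at each maximal ideal is a valuation domain; a $G$-domain is an integral domain in which the intersection of all nonzero prime ideals is nonzero (a field, having no nonzero prime ideals, is a $G$-domain); a Prüfer $G$-domain is an integral domain that is both. Theorem. Let $X_1$ be a nonempty set of rank one valuation rings in $\mathrm{Zar}(F)$, and let $X_2\subseteq\mathrm{Zar}(F)$ be such that $\lim(X_1)\subseteq X_2$. Then the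 following are equivalent. (1) $J(X_1)\neq 0$ and $A(X_2)$ is a Prüfer $G$-domain with quotient field $F$. (2) $A(X_1)\cap A(X_2)$ is a Prüfer $G$-domain with quotient field $F$. -/

import Mathlib

open Set Topology

namespace ZariskiRiemann

universe u

section Field

variable (F : Type u) [Field F]

/-- The basic patch-open set of all valuation rings `V` of `F` with `S ⊆ V` and `y ∉ V` for all
`y ∈ T`, where `S` and `T` are finite subsets of `F`. -/
def patchBasic (S T : Finset F) : Set (ValuationSubring F) :=
  {V | (∀ x ∈ S, x ∈ V) ∧ ∀ y ∈ T, y ∉ V}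

/-- The patch (constructible) topology on the set `Zar(F)` of all valuation rings of `F`. The
valuation ring `F` itself (`⊤`) is one of the points. -/
@[reducible]
def patchTopology : TopologicalSpace (ValuationSubring F) :=
  TopologicalSpace.generateFrom {U | ∃ S T : Finset F, U = patchBasic F S T}

/-- The generating sets really are a basis of the patch topology. -/
theorem isTopologicalBasis_patchBasic :
    @TopologicalSpace.IsTopologicalBasis _ (patchTopology F)
      {U | ∃ S T : Finset F, U = patchBasic F S T} := by
  classical
  let _ := patchTopology F
  refine ⟨?_, ?_, rfl⟩
  · rintro _ ⟨S₁, T₁, rfl⟩ _ ⟨S₂, T₂, rfl⟩ V ⟨⟨h₁, h₂⟩, h₃, h₄⟩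
    refine ⟨_, ⟨S₁ ∪ S₂, T₁ ∪ T₂, rfl⟩, ⟨?_, ?_⟩, ?_⟩
    · intro x hx
      rcases Finset.mem_union.1 hx with h | h
      exacts [h₁ x h, h₃ x h]
    · intro x hx
      rcases Finset.mem_union.1 hx with h | h
      exacts [h₂ x h, h₄ x h]
    · rintro W ⟨hS, hT⟩
      exact ⟨⟨fun x hx => hS x (Finset.mem_union_left _ hx),
          fun x hx => hT x (Finset.mem_union_left _ hx)⟩,
        fun x hx => hS x (Finset.mem_union_right _ hx),
        fun x hx => hT x (Finset.mem_union_right _ hx)⟩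
  · refine Set.eq_univ_of_forall fun V => Set.mem_sUnion.2 ⟨_, ⟨∅, ∅, rfl⟩, ?_⟩
    exact ⟨by simp, by simp⟩

variable {F}

/-- `lim(X)`: the set of limit (accumulation) points in `Zar(F)` of `X` in the patch topology. -/
def lim (X : Set (ValuationSubring F)) : Set (ValuationSubring F) :=
  @derivedSet _ (patchTopology F) X

/-- `A(X)`: the intersection of the valuation rings in `X`. It is `F` if `X` is empty. -/
def A (X : Set (ValuationSubring F)) : Subring F :=
  ⨅ V ∈ X, V.toSubring

/-- `J(X)`: the intersection of the maximal ideals of the valuation rings in `X`, as a subset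
of `F`. -/
def J (X : Set (ValuationSubring F)) : Set F :=
  ⋂ V ∈ X, (fun a : V => (a : F)) '' (IsLocalRing.maximalIdeal V : Set V)

/-- A valuation ring has rank one if its Krull dimension is one. -/
def IsRankOne (V : ValuationSubring F) : Prop :=
  ringKrullDim V = 1

end Field

section Domain

variable (R : Type u) [CommRing R] [IsDomain R]

/-- A domain is a Prüfer domain if its localization at each maximal ideal is a valuation
domain. -/
def IsPruferDomain : Prop :=
  ∀ (M : Ideal R) [M.IsMaximal], ValuationRing (Localization.AtPrime M)

/-- A domain is a `G`-domain if the intersection of its nonzero prime ideals is nonzero. A field is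
a `G`-domain: there the intersection is over the empty family, hence the whole ring. -/
def IsGDomain : Prop :=
  sInf {P : Ideal R | P.IsPrime ∧ P ≠ ⊥} ≠ ⊥

end Domain

/-- The subring `R` of the field `F` is a Prüfer `G`-domain with quotient field `F`. -/
def IsPruferGDomainWithQuotientField {F : Type u} [Field F] (R : Subring F) : Prop :=
  IsPruferDomain R ∧ IsGDomain R ∧ IsFractionRing R F

end ZariskiRiemann

/-! Put R = A(X₂) and let Y consist of X₁ and all valuation overrings of R. Then A(X₁) ∩ A(X₂) =
A(Y), and since the limit points of X₁ contain R, Y is closed under ultrafilter limits. This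
compactness makes exponents uniform over Y (`IsUltraClosed.exists_uniform`).

For (1) ⇒ (2), `exists_common_small` merges the data from J(X₁) and R into one t ≠ 0 that lies in
the maximal ideal of each V ≠ F in Y and has powers clearing any pole. Uniformity then gives the
quotient field and the G-property. The Prüfer property is tested as solvability of a + bw = 1 with
a, b, aw, bw in the ring. A solution over R fails only on a closed set of rank one members of Y.
There a second solution is built from w alone, and the two are glued by an element t-adically close
to 1 on that set and to 0 off it (`exists_approx_idempotent_finset`).

For (2) ⇒ (1), all three properties pass to overrings, and an element of every nonzero prime of
A(X₁) ∩ A(X₂) lies in J(X₁). -/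

namespace ZariskiRiemann

section

variable {F : Type*} [Field F]

/-! ### Ultrafilter limits of valuation rings -/

/-- The limit of an ultrafilter of valuation rings: the elements that lie in almost all of them. -/
def limitRing (U : Ultrafilter (ValuationSubring F)) : ValuationSubring F where
  carrier := {x | ∀ᶠ W in (U : Filter (ValuationSubring F)), x ∈ W}
  mul_mem' := fun ha hb => by
    filter_upwards [ha, hb] with W h₁ h₂ using mul_mem h₁ h₂
  one_mem' := Filter.Eventually.of_forall fun W => W.one_mem
  add_mem' := fun ha hb => by
    filter_upwards [ha, hb] with W h₁ h₂ using add_mem h₁ h₂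
  zero_mem' := Filter.Eventually.of_forall fun W => W.zero_mem
  neg_mem' := fun ha => by
    filter_upwards [ha] with W h₁ using neg_mem h₁
  mem_or_inv_mem' := fun x => by
    simp only [Set.mem_ofPred_eq]
    exact Ultrafilter.eventually_or.1 (Filter.Eventually.of_forall fun W => W.mem_or_inv_mem x)

/-- A set of valuation rings containing the limits of its ultrafilters. -/
def IsUltraClosed (Y : Set (ValuationSubring F)) : Prop :=
  ∀ U : Ultrafilter (ValuationSubring F), Y ∈ U → limitRing U ∈ Y

/-- If each n failed at some V n, a nonprincipal limit of the V n would contain some c n. Then c n ∈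
V k for some k ≥ n, and monotonicity gives c k ∈ V k, a contradiction. -/
theorem IsUltraClosed.exists_uniform {Y : Set (ValuationSubring F)} (hY : IsUltraClosed Y)
    (c : ℕ → F) (hc : ∀ V ∈ Y, ∀ n, c n ∈ V → c (n + 1) ∈ V) (h : ∀ V ∈ Y, ∃ n, c n ∈ V) :
    ∃ n, ∀ V ∈ Y, c n ∈ V := by
  by_contra! hcon
  choose V hVY hV using hcon
  let U : Ultrafilter (ValuationSubring F) := (Filter.hyperfilter ℕ).map V
  have hU : Y ∈ U := Ultrafilter.mem_map.2 (Filter.univ_mem' hVY)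
  obtain ⟨n, hn⟩ := h _ (hY U hU)
  have h₁ : ∀ᶠ k in (Filter.hyperfilter ℕ : Filter ℕ), c n ∈ V k := hn
  have h₂ : ∀ᶠ k in (Filter.hyperfilter ℕ : Filter ℕ), n ≤ k := by
    exact (Filter.hyperfilter_le_cofinite (α := ℕ))
      (Nat.cofinite_eq_atTop ▸ Filter.eventually_ge_atTop n)
  obtain ⟨k, hk, hnk⟩ := (h₁.and h₂).exists
  exact hV k (Nat.le_induction (P := fun m _ => c m ∈ V k) hk
    (fun m _ ih => hc _ (hVY k) m ih) k hnk)

theorem IsUltraClosed.sep_notMem {Y : Set (ValuationSubring F)} (hY : IsUltraClosed Y)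
    (S : Finset F) : IsUltraClosed {V | V ∈ Y ∧ ∃ f ∈ S, f ∉ V} := by
  intro U hU
  refine ⟨hY U (Filter.mem_of_superset hU fun V hV => hV.1), ?_⟩
  by_contra! h
  have h₁ : ∀ᶠ V in (U : Filter (ValuationSubring F)), ∀ f ∈ S, f ∈ V :=
    (Filter.eventually_all_finset S).2 fun f hf => h f hf
  obtain ⟨V, hV, hV'⟩ := (h₁.and hU).exists
  obtain ⟨f, hf, hfV⟩ := hV'.2
  exact hfV (hV f hf)

/-- The union of `X` with the set of valuation overrings of `R` is closed as soon as these overrings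
contain the limit points of `X`. -/
theorem isUltraClosed_union {X : Set (ValuationSubring F)} {R : Subring F}
    (h : ∀ V ∈ lim X, R ≤ V.toSubring) :
    IsUltraClosed (X ∪ {V : ValuationSubring F | R ≤ V.toSubring}) := by
  intro U hU
  rcases Ultrafilter.union_mem_iff.1 hU with hX | hR
  -- A limit along an ultrafilter on X that is not itself in X is an accumulation point of X.
  · by_cases hV : limitRing U ∈ X
    · exact Or.inl hV
    · refine Or.inr (h _ ?_)
      let _ := patchTopology F
      change AccPt (limitRing U) (Filter.principal X)
      rw [accPt_iff_nhds]
      intro N hN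
      obtain ⟨_, ⟨S, T, rfl⟩, ⟨hS, hT⟩, hN⟩ :=
        (isTopologicalBasis_patchBasic F).mem_nhds_iff.1 hN
      have h₁ : ∀ᶠ V in (U : Filter (ValuationSubring F)), ∀ f ∈ S, f ∈ V :=
        (Filter.eventually_all_finset S).2 fun f hf => hS f hf
      have h₂ : ∀ᶠ V in (U : Filter (ValuationSubring F)), ∀ f ∈ T, f ∉ V :=
        (Filter.eventually_all_finset T).2 fun f hf =>
          Ultrafilter.eventually_not.2 (hT f hf)
      obtain ⟨V, ⟨hVS, hVT⟩, hVX⟩ := ((h₁.and h₂).and hX).exists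
      exact ⟨V, ⟨hN ⟨hVS, hVT⟩, hVX⟩, fun e => hV (e ▸ hVX)⟩
  · exact Or.inr fun x hx => Filter.mem_of_superset hR fun V hV => hV hx

/-! ### Elements all of whose multiples become integral -/

/-- Every element of `F` is moved into `V` by some power of `x`. -/
def Absorbs (V : ValuationSubring F) (x : F) : Prop :=
  ∀ c : F, ∃ n : ℕ, x ^ n * c ∈ V

/-- If c⁻¹ ∈ V is nonzero, every prime containing it contains x, so some power of x is a multiple of
c⁻¹. -/
theorem absorbs_of_mem_primes {V : ValuationSubring F} {x : V}
    (h : ∀ P : Ideal V, P.IsPrime → P ≠ ⊥ → x ∈ P) : Absorbs V (x : F) := by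
  intro c
  rcases V.mem_or_inv_mem c with hc | hc
  · exact ⟨0, by simpa using hc⟩
  · rcases eq_or_ne c 0 with rfl | hc0
    · exact ⟨0, by simp⟩
    have hx : x ∈ (Ideal.span {(⟨c⁻¹, hc⟩ : V)}).radical := by
      rw [Ideal.radical_eq_sInf, Ideal.mem_sInf]
      rintro P ⟨hP, hPp⟩
      refine h P hPp ?_
      rintro rfl
      have := Ideal.span_le.1 hP (Set.mem_singleton _)
      have h0 : (⟨c⁻¹, hc⟩ : V) = 0 := this
      exact inv_ne_zero hc0 (congrArg Subtype.val h0)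
    obtain ⟨n, hn⟩ := hx
    obtain ⟨a, ha⟩ := Ideal.mem_span_singleton.1 hn
    refine ⟨n, ?_⟩
    have e : (x : F) ^ n = c⁻¹ * a := by simpa using congrArg Subtype.val ha
    rw [e, mul_comm, ← mul_assoc, mul_inv_cancel₀ hc0, one_mul]
    exact a.2

theorem IsRankOne.absorbs {V : ValuationSubring F} (hV : IsRankOne V) {x : F}
    (hx : V.valuation x < 1) : Absorbs V x := by
  have : Ring.KrullDimLE 1 V := Ring.krullDimLE_iff.2 (le_of_eq hV)
  have hxV : x ∈ V := (V.valuation_le_one_iff x).1 hx.le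
  refine absorbs_of_mem_primes (x := ⟨x, hxV⟩) fun P hP hP0 => ?_
  have := hP.isMaximal_of_ne_bot hP0
  rw [IsLocalRing.eq_maximalIdeal this, ValuationSubring.valuation_lt_one_iff]
  exact hx

theorem IsRankOne.ne_top {V : ValuationSubring F} (hV : IsRankOne V) : V ≠ ⊤ := by
  rintro rfl
  have : IsField (⊤ : ValuationSubring F) := by
    refine ⟨⟨0, 1, zero_ne_one⟩, mul_comm, fun {a} ha => ⟨⟨(a : F)⁻¹, trivial⟩, ?_⟩⟩
    exact Subtype.ext (mul_inv_cancel₀ fun h => ha (Subtype.ext h))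
  have h0 := ringKrullDim_eq_zero_of_isField this
  rw [IsRankOne, h0] at hV
  exact zero_ne_one hV

theorem inv_notMem_iff (V : ValuationSubring F) {x : F} (hx : x ≠ 0) :
    x⁻¹ ∉ V ↔ V.valuation x < 1 := by
  rw [← V.valuation_le_one_iff, map_inv₀, not_le,
    one_lt_inv₀ (zero_lt_iff.2 ((map_ne_zero _).2 hx))]

theorem inv_one_add_mem (V : ValuationSubring F) {x : F} (hx : V.valuation x < 1) :
    (1 + x)⁻¹ ∈ V := by
  rw [← V.valuation_le_one_iff, map_inv₀, V.valuation.map_one_add_of_lt hx, inv_one]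

theorem mem_of_lt_one {V : ValuationSubring F} {x : F} (hx : V.valuation x < 1) : x ∈ V :=
  (V.valuation_le_one_iff x).1 hx.le

theorem lt_one_mul_mem {V : ValuationSubring F} {x y : F} (hx : V.valuation x < 1) (hy : y ∈ V) :
    V.valuation (x * y) < 1 := by
  rw [map_mul]
  exact mul_lt_one_of_lt_of_le hx ((V.valuation_le_one_iff y).2 hy)

/-! ### Approximate idempotents -/

/-- A single element `e` that is close to `1` where `f` has a pole and close to `0` elsewhere. -/
theorem exists_approx_idempotent {Y : Set (ValuationSubring F)} (hY : IsUltraClosed Y) {t : F}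
    (ht0 : t ≠ 0) (ht : ∀ V ∈ Y, V = ⊤ ∨ V.valuation t < 1) (f : F)
    (hf : ∀ V ∈ Y, f ∉ V → Absorbs V f⁻¹) (n : ℕ) :
    ∃ e : F, ∀ V ∈ Y, (f ∉ V → (1 - e) / t ^ n ∈ V) ∧ (f ∈ V → e / t ^ n ∈ V) := by
  classical
  rcases eq_or_ne f 0 with rfl | hf0
  · exact ⟨0, fun V _ => ⟨fun h => absurd V.zero_mem h, fun _ => by simp⟩⟩
  -- The exponent 2n + 2 leaves a factor t ^ (n + 1) in q⁻¹ at the poles of f, matching the one in q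
  -- elsewhere.
  obtain ⟨N, hN⟩ := (hY.sep_notMem {f}).exists_uniform
    (fun N => f⁻¹ ^ N * (t ^ (2 * n + 2))⁻¹)
    (fun V hV N h => by
      have : f⁻¹ ∈ V := (V.mem_or_inv_mem f).resolve_left (by simpa using hV.2)
      rw [pow_succ', mul_assoc]
      exact mul_mem this h)
    (fun V hV => hf V hV.1 (by simpa using hV.2) _)
  replace hN : ∀ V ∈ Y, f ∉ V → f⁻¹ ^ N * (t ^ (2 * n + 2))⁻¹ ∈ V := fun V hV h =>
    hN V ⟨hV, by simpa using h⟩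
  set q := f ^ N * t ^ (n + 1) with hq
  have hq0 : q ≠ 0 := by positivity
  refine ⟨q / (1 + q), fun V hV => ?_⟩
  -- Only at V = F can 1 + q vanish, and there nothing is to be proved.
  rcases ht V hV with rfl | htV
  · exact ⟨fun _ => trivial, fun _ => trivial⟩
  have htm : t ∈ V := mem_of_lt_one htV
  refine ⟨fun hfV => ?_, fun hfV => ?_⟩
  · have hu := hN V hV hfV
    set u := f⁻¹ ^ N * (t ^ (2 * n + 2))⁻¹ with hu'
    have hqu : q⁻¹ = t ^ (n + 1) * u := by
      rw [hq, hu', inv_pow]; field_simp; ring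
    have hlt : V.valuation q⁻¹ < 1 := by
      rw [hqu, pow_succ', mul_assoc]
      exact lt_one_mul_mem htV (mul_mem (pow_mem htm n) hu)
    have h1 : 1 + q⁻¹ ≠ 0 := by
      intro h
      have := V.valuation.map_one_add_of_lt hlt
      simp [h] at this
    have h2 : 1 + q ≠ 0 := by
      intro h; apply h1; field_simp; rw [add_comm, h, mul_zero]
    have e : (1 - q / (1 + q)) / t ^ n = (1 + q⁻¹)⁻¹ * (t * u) := by
      have : t * u = q⁻¹ / t ^ n := by rw [hqu]; field_simp; ring
      rw [this]
      have h3 : q + 1 ≠ 0 := by rwa [add_comm]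
      field_simp
      ring
    rw [e]
    exact mul_mem (inv_one_add_mem V hlt) (mul_mem htm hu)
  · have hlt : V.valuation q < 1 := by
      have : q = t * (f ^ N * t ^ n) := by rw [hq]; ring
      rw [this]
      exact lt_one_mul_mem htV (mul_mem (pow_mem hfV N) (pow_mem htm n))
    have e : q / (1 + q) / t ^ n = (1 + q)⁻¹ * (f ^ N * t) := by
      rw [hq, pow_succ]; field_simp
    rw [e]
    exact mul_mem (inv_one_add_mem V hlt) (mul_mem (pow_mem hfV N) htm)

theorem exists_approx_idempotent_finset {Y : Set (ValuationSubring F)} (hY : IsUltraClosed Y)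
    {t : F} (ht0 : t ≠ 0) (ht : ∀ V ∈ Y, V = ⊤ ∨ V.valuation t < 1) (S : Finset F)
    (hS : ∀ f ∈ S, ∀ V ∈ Y, f ∉ V → Absorbs V f⁻¹) (n : ℕ) :
    ∃ e : F, ∀ V ∈ Y, ((∃ f ∈ S, f ∉ V) → (1 - e) / t ^ n ∈ V) ∧
      ((∀ f ∈ S, f ∈ V) → e / t ^ n ∈ V) := by
  classical
  have htm : ∀ V ∈ Y, t ^ n ∈ V := fun V hV => by
    rcases ht V hV with rfl | h
    exacts [trivial, pow_mem (mem_of_lt_one h) n]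
  have htn : t ^ n ≠ 0 := pow_ne_zero n ht0
  induction S using Finset.induction_on with
  | empty => exact ⟨0, fun V _ => ⟨by simp, by simp⟩⟩
  | insert f S _ ih =>
    obtain ⟨e₁, h₁⟩ := exists_approx_idempotent hY ht0 ht f
      (hS f (Finset.mem_insert_self _ _)) n
    obtain ⟨e₂, h₂⟩ := ih fun g hg => hS g (Finset.mem_insert_of_mem hg)
    -- The Boolean join of the two approximate idempotents.
    refine ⟨1 - (1 - e₁) * (1 - e₂), fun V hV => ?_⟩
    obtain ⟨a₁, b₁⟩ := h₁ V hV
    obtain ⟨a₂, b₂⟩ := h₂ V hV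
    have mem : ∀ {x : F}, x / t ^ n ∈ V → x ∈ V := fun {x} hx => by
      have := mul_mem hx (htm V hV)
      rwa [div_mul_cancel₀ x htn] at this
    have mem' : ∀ {x : F}, 1 - x ∈ V → x ∈ V := fun {x} hx => by
      simpa using sub_mem V.one_mem hx
    have c₁ : e₁ ∈ V := by
      by_cases h : f ∈ V
      exacts [mem (b₁ h), mem' (mem (a₁ h))]
    have c₂ : e₂ ∈ V := by
      by_cases h : ∀ g ∈ S, g ∈ V
      · exact mem (b₂ h)
      · exact mem' (mem (a₂ (by simpa using h)))
    rw [sub_sub_cancel]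
    refine ⟨fun h => ?_, fun h => ?_⟩
    · rw [Finset.exists_mem_insert] at h
      rcases h with h | h
      · rw [mul_div_right_comm]
        exact mul_mem (a₁ h) (sub_mem V.one_mem c₂)
      · rw [mul_div_assoc]
        exact mul_mem (sub_mem V.one_mem c₁) (a₂ h)
    · rw [Finset.forall_mem_insert] at h
      have e : (1 - (1 - e₁) * (1 - e₂)) / t ^ n
          = e₁ / t ^ n + e₂ / t ^ n * (1 - e₁) := by
        field_simp; ring
      rw [e]
      exact add_mem (b₁ h.1) (mul_mem (b₂ h.2) (sub_mem V.one_mem c₁))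

/-! ### Prüfer domains, `G`-domains and quotient fields for subrings of a field -/

theorem isFractionRing_iff (R : Subring F) :
    IsFractionRing R F ↔ ∀ x : F, ∃ b ∈ R, b ≠ 0 ∧ b * x ∈ R := by
  constructor
  · intro h x
    obtain ⟨a, b, hb, rfl⟩ := IsFractionRing.div_surjective (A := R) x
    have hb0 : (b : F) ≠ 0 := fun h => nonZeroDivisors.ne_zero hb (Subtype.ext h)
    refine ⟨b, b.2, hb0, ?_⟩
    change (b : F) * (a / b) ∈ R
    rw [mul_div_cancel₀ _ hb0]
    exact a.2
  · intro h
    refine IsFractionRing.of_field R F fun x => ?_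
    obtain ⟨b, hb, hb0, hbx⟩ := h x
    refine ⟨⟨_, hbx⟩, ⟨b, hb⟩, ?_⟩
    change x = b * x / b
    field_simp

/-- Every two-generated fractional ideal `(1, w)` of `R` is invertible. -/
def HasInvertiblePairs (R : Subring F) : Prop :=
  ∀ w : F, ∃ a b : F, a ∈ R ∧ b ∈ R ∧ a * w ∈ R ∧ b * w ∈ R ∧ a + b * w = 1

theorem HasInvertiblePairs.mono {R S : Subring F} (h : HasInvertiblePairs R) (hRS : R ≤ S) :
    HasInvertiblePairs S := fun w => by
  obtain ⟨a, b, h₁, h₂, h₃, h₄, h₅⟩ := h w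
  exact ⟨a, b, hRS h₁, hRS h₂, hRS h₃, hRS h₄, h₅⟩

/-- For w = q / p, one of a and bw lies outside M, as their sum is 1. In the first case p divides q
locally, in the second q divides p. -/
theorem HasInvertiblePairs.isPruferDomain {R : Subring F} (h : HasInvertiblePairs R) :
    IsPruferDomain R := by
  intro M hM
  have key : ∀ p q : R,
      (algebraMap R (Localization.AtPrime M) p ∣ algebraMap R (Localization.AtPrime M) q) ∨
      (algebraMap R (Localization.AtPrime M) q ∣ algebraMap R (Localization.AtPrime M) p) := by
    intro p q
    rcases eq_or_ne p 0 with rfl | hp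
    · exact Or.inr (by simp)
    have hp0 : (p : F) ≠ 0 := fun h => hp (Subtype.ext h)
    obtain ⟨a, b, ha, hb, haw, hbw, e⟩ := h ((q : F) / p)
    have e₁ : (⟨a, ha⟩ : R) * q = ⟨_, haw⟩ * p := Subtype.ext (by
      change a * (q : F) = a * (q / p) * p
      field_simp)
    have e₂ : (⟨_, hbw⟩ : R) * p = ⟨b, hb⟩ * q := Subtype.ext (by
      change b * ((q : F) / p) * p = b * q
      field_simp)
    have e₃ : (⟨a, ha⟩ : R) + ⟨_, hbw⟩ = 1 := Subtype.ext e
    have dvd : ∀ s r x y : R, s ∉ M → s * x = r * y →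
        algebraMap R (Localization.AtPrime M) y ∣ algebraMap R (Localization.AtPrime M) x := by
      intro s r x y hs hsx
      have hu : IsUnit (algebraMap R (Localization.AtPrime M) s) :=
        IsLocalization.map_units (Localization.AtPrime M) (⟨s, hs⟩ : M.primeCompl)
      rw [← hu.dvd_mul_left, ← map_mul, hsx, map_mul]
      exact Dvd.intro_left _ rfl
    by_cases haM : (⟨a, ha⟩ : R) ∈ M
    · have hbM : (⟨_, hbw⟩ : R) ∉ M := fun hbM =>
        hM.ne_top ((Ideal.eq_top_iff_one M).2 (e₃ ▸ M.add_mem haM hbM))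
      exact Or.inr (dvd _ _ _ _ hbM e₂)
    · exact Or.inl (dvd _ _ _ _ haM e₁)
  rw [ValuationRing.iff_dvd_total]
  refine ⟨fun x y => ?_⟩
  obtain ⟨⟨p, s⟩, hs⟩ := IsLocalization.surj M.primeCompl x
  obtain ⟨⟨q, r⟩, hr⟩ := IsLocalization.surj M.primeCompl y
  have hsu := IsLocalization.map_units (Localization.AtPrime M) s
  have hru := IsLocalization.map_units (Localization.AtPrime M) r
  have := key p q
  rwa [← hs, ← hr, hsu.mul_right_dvd, hru.dvd_mul_right, hru.mul_right_dvd,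
    hsu.dvd_mul_right] at this

theorem IsPruferDomain.hasInvertiblePairs {R : Subring F} (h : IsPruferDomain R)
    (hR : IsFractionRing R F) : HasInvertiblePairs R := by
  intro w
  -- The ideal of all r for which a + bw = r is solvable. If it lay in a maximal M, then w or w⁻¹
  -- would be in the valuation ring at M, and clearing denominators would put some s ∉ M into K, by
  -- (s, 0) or (0, r).
  let K : Ideal R :=
    { carrier := {r | ∃ a b : F, a ∈ R ∧ b ∈ R ∧ a * w ∈ R ∧ b * w ∈ R ∧ a + b * w = r}
      zero_mem' := ⟨0, 0, by simp [R.zero_mem]⟩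
      add_mem' := by
        rintro r s ⟨a, b, h₁, h₂, h₃, h₄, h₅⟩ ⟨a', b', h₁', h₂', h₃', h₄', h₅'⟩
        refine ⟨a + a', b + b', add_mem h₁ h₁', add_mem h₂ h₂', ?_, ?_, ?_⟩
        · rw [add_mul]; exact add_mem h₃ h₃'
        · rw [add_mul]; exact add_mem h₄ h₄'
        · rw [Subring.coe_add, ← h₅, ← h₅']; ring
      smul_mem' := by
        rintro c r ⟨a, b, h₁, h₂, h₃, h₄, h₅⟩
        refine ⟨c * a, c * b, mul_mem c.2 h₁, mul_mem c.2 h₂, ?_, ?_, ?_⟩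
        · rw [mul_assoc]; exact mul_mem c.2 h₃
        · rw [mul_assoc]; exact mul_mem c.2 h₄
        · rw [smul_eq_mul, Subring.coe_mul, ← h₅]; ring }
  by_contra hcon
  have hK : K ≠ ⊤ := by
    intro hK
    obtain ⟨a, b, h₁, h₂, h₃, h₄, h₅⟩ := (Ideal.eq_top_iff_one K).1 hK
    exact hcon ⟨a, b, h₁, h₂, h₃, h₄, h₅⟩
  obtain ⟨M, hM, hKM⟩ := Ideal.exists_le_maximal K hK
  obtain ⟨d, hd, hd0, hdw⟩ := (isFractionRing_iff R).1 hR w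
  have hval := h M
  have dvd : ∀ p q : R,
      algebraMap R (Localization.AtPrime M) p ∣ algebraMap R (Localization.AtPrime M) q →
      ∃ s : R, s ∉ M ∧ p ∣ s * q := by
    rintro p q ⟨z, hz⟩
    obtain ⟨⟨r, s⟩, hs⟩ := IsLocalization.surj M.primeCompl z
    refine ⟨s, s.2, r, ?_⟩
    apply IsLocalization.injective (Localization.AtPrime M) M.primeCompl_le_nonZeroDivisors
    rw [map_mul, map_mul, ← hs, hz]
    ring
  rcases (ValuationRing.iff_dvd_total.1 hval).total
      (algebraMap R (Localization.AtPrime M) ⟨d, hd⟩)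
      (algebraMap R (Localization.AtPrime M) ⟨_, hdw⟩) with hz | hz
  · obtain ⟨s, hs, r, hr⟩ := dvd _ _ hz
    have hr' : (s : F) * (d * w) = d * r := congrArg Subtype.val hr
    have e : (s : F) * w = r := mul_left_cancel₀ hd0 (by rw [← hr']; ring)
    exact hs (hKM ⟨s, 0, s.2, R.zero_mem, e ▸ r.2, by simp [R.zero_mem], by simp⟩)
  · obtain ⟨s, hs, r, hr⟩ := dvd _ _ hz
    have hr' : (s : F) * d = d * w * r := congrArg Subtype.val hr
    have e : (r : F) * w = s := mul_left_cancel₀ hd0 (by rw [mul_comm d s, hr']; ring)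
    exact hs (hKM ⟨0, r, R.zero_mem, r.2, by simp [R.zero_mem], e ▸ s.2, by simp [e]⟩)

theorem isGDomain_iff (R : Subring F) :
    IsGDomain R ↔ ∃ g : R, g ≠ 0 ∧ ∀ P : Ideal R, P.IsPrime → P ≠ ⊥ → g ∈ P := by
  rw [IsGDomain, Submodule.ne_bot_iff]
  simp only [Ideal.mem_sInf, Set.mem_ofPred_eq, and_imp]
  exact ⟨fun ⟨g, h, h0⟩ => ⟨g, h0, fun P => h (I := P)⟩, fun ⟨g, h0, h⟩ => ⟨g, fun {P} => h P, h0⟩⟩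

/-- A nonzero prime ideal of an overring `S` of `R` lies over a nonzero prime ideal of `R`. -/
theorem mem_of_mem_primes {R S : Subring F} (hRS : R ≤ S) (hR : IsFractionRing R F) {g : R}
    (hg : ∀ P : Ideal R, P.IsPrime → P ≠ ⊥ → g ∈ P) (Q : Ideal S) (hQ : Q.IsPrime)
    (hQ0 : Q ≠ ⊥) : Subring.inclusion hRS g ∈ Q := by
  refine hg (Q.comap (Subring.inclusion hRS)) (hQ.comap _) fun h => ?_
  obtain ⟨q, hq, hq0⟩ := (Submodule.ne_bot_iff Q).1 hQ0
  obtain ⟨b, hb, hb0, hbq⟩ := (isFractionRing_iff R).1 hR q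
  have : (⟨_, hbq⟩ : R) ∈ Q.comap (Subring.inclusion hRS) :=
    Q.mul_mem_left ⟨b, hRS hb⟩ hq
  rw [h] at this
  exact mul_ne_zero hb0 (fun h => hq0 (Subtype.ext h)) (congrArg Subtype.val this)

theorem valuation_lt_one_of_mem_primes {R : Subring F} {V : ValuationSubring F}
    (hRV : R ≤ V.toSubring) (hR : IsFractionRing R F) {g : R}
    (hg : ∀ P : Ideal R, P.IsPrime → P ≠ ⊥ → g ∈ P) (hV : V ≠ ⊤) : V.valuation g < 1 := by
  have : IsLocalRing.maximalIdeal V ≠ ⊥ := by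
    intro h
    refine hV (top_le_iff.1 fun x _ => ?_)
    rcases V.mem_or_inv_mem x with hx | hx
    · exact hx
    rcases eq_or_ne x 0 with rfl | hx0
    · exact V.zero_mem
    have h1 : (⟨x⁻¹, hx⟩ : V) ∉ IsLocalRing.maximalIdeal V := by
      rw [h]
      exact fun h => inv_ne_zero hx0 (congrArg Subtype.val (show _ = (0 : V) from h))
    rw [ValuationSubring.valuation_lt_one_iff, not_lt, map_inv₀,
      one_le_inv₀ (zero_lt_iff.2 ((map_ne_zero _).2 hx0))] at h1
    exact (V.valuation_le_one_iff x).1 h1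
  have := mem_of_mem_primes hRV hR hg (IsLocalRing.maximalIdeal V) inferInstance this
  exact (V.valuation_lt_one_iff _).1 this

theorem absorbs_of_mem_primes_of_le {R : Subring F} {V : ValuationSubring F}
    (hRV : R ≤ V.toSubring) (hR : IsFractionRing R F) {g : R}
    (hg : ∀ P : Ideal R, P.IsPrime → P ≠ ⊥ → g ∈ P) : Absorbs V (g : F) :=
  absorbs_of_mem_primes (x := Subring.inclusion hRV g)
    fun P hP hP0 => mem_of_mem_primes (S := V.toSubring) hRV hR hg P hP hP0

theorem IsPruferGDomainWithQuotientField.mono {R S : Subring F} (hRS : R ≤ S)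
    (h : IsPruferGDomainWithQuotientField R) : IsPruferGDomainWithQuotientField S := by
  obtain ⟨hP, hG, hR⟩ := h
  refine ⟨((hP.hasInvertiblePairs hR).mono hRS).isPruferDomain, ?_, ?_⟩
  · obtain ⟨g, hg0, hg⟩ := (isGDomain_iff R).1 hG
    refine (isGDomain_iff S).2 ⟨Subring.inclusion hRS g, ?_, mem_of_mem_primes hRS hR hg⟩
    exact fun h => hg0 (Subtype.ext (congrArg (fun s : S => (s : F)) h))
  · refine (isFractionRing_iff S).2 fun x => ?_
    obtain ⟨b, hb, hb0, hbx⟩ := (isFractionRing_iff R).1 hR x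
    exact ⟨b, hRS hb, hb0, hRS hbx⟩

theorem mem_A {X : Set (ValuationSubring F)} {x : F} : x ∈ A X ↔ ∀ V ∈ X, x ∈ V := by
  simp [A, Subring.mem_iInf]

theorem mem_J {X : Set (ValuationSubring F)} {x : F} :
    x ∈ J X ↔ ∀ V ∈ X, V.valuation x < 1 := by
  simp only [J, Set.mem_iInter₂]
  refine forall₂_congr fun V _ => ⟨?_, fun h => ?_⟩
  · rintro ⟨a, ha, rfl⟩
    exact (V.valuation_lt_one_iff a).1 ha
  · exact ⟨⟨x, mem_of_lt_one h⟩, (V.valuation_lt_one_iff _).2 h, rfl⟩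

theorem J_ne_zero_iff {X : Set (ValuationSubring F)} :
    J X ≠ {0} ↔ ∃ j ≠ 0, j ∈ J X := by
  constructor
  · intro h
    by_contra! hcon
    refine h (Set.eq_singleton_iff_unique_mem.2 ⟨mem_J.2 fun V _ => by simp, fun x hx => ?_⟩)
    by_contra hx0
    exact hcon x hx0 hx
  · rintro ⟨j, hj0, hj⟩ h
    rw [h] at hj
    exact hj0 hj

/-! ### Intersections of ultrafilter-closed sets of valuation rings -/

section Closed

variable {Y : Set (ValuationSubring F)} {t : F}

theorem exists_pow_mul_mem (hY : IsUltraClosed Y)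
    (ht : ∀ V ∈ Y, V = ⊤ ∨ V.valuation t < 1) (ha : ∀ V ∈ Y, Absorbs V t) (c : F) :
    ∃ n, ∀ m, n ≤ m → ∀ V ∈ Y, t ^ m * c ∈ V := by
  have step : ∀ V ∈ Y, ∀ n, t ^ n * c ∈ V → t ^ (n + 1) * c ∈ V := fun V hV n h => by
    rcases ht V hV with rfl | htV
    · trivial
    · rw [pow_succ', mul_assoc]
      exact mul_mem (mem_of_lt_one htV) h
  obtain ⟨n, hn⟩ := hY.exists_uniform (fun n => t ^ n * c) step fun V hV => ha V hV c
  exact ⟨n, fun m hm V hV => Nat.le_induction (P := fun m _ => t ^ m * c ∈ V) (hn V hV)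
    (fun k _ => step V hV k) m hm⟩

theorem exists_pow_mul_mem_finset (hY : IsUltraClosed Y)
    (ht : ∀ V ∈ Y, V = ⊤ ∨ V.valuation t < 1) (ha : ∀ V ∈ Y, Absorbs V t) (S : Finset F) :
    ∃ n, ∀ c ∈ S, ∀ V ∈ Y, t ^ n * c ∈ V := by
  choose n hn using exists_pow_mul_mem hY ht ha
  exact ⟨S.sup n, fun c hc => hn c _ (Finset.le_sup hc)⟩

theorem isFractionRing_A (ht0 : t ≠ 0) (hY : IsUltraClosed Y)
    (ht : ∀ V ∈ Y, V = ⊤ ∨ V.valuation t < 1) (ha : ∀ V ∈ Y, Absorbs V t) :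
    IsFractionRing (A Y) F := by
  refine (isFractionRing_iff _).2 fun x => ?_
  obtain ⟨n, hn⟩ := exists_pow_mul_mem hY ht ha x
  refine ⟨t ^ n, mem_A.2 fun V hV => ?_, pow_ne_zero n ht0, mem_A.2 (hn n le_rfl)⟩
  rcases ht V hV with rfl | htV
  exacts [trivial, pow_mem (mem_of_lt_one htV) n]

/-- Each nonzero p in A(Y) divides a power of t there, so t lies in every nonzero prime. -/
theorem isGDomain_A (ht0 : t ≠ 0) (hY : IsUltraClosed Y)
    (ht : ∀ V ∈ Y, V = ⊤ ∨ V.valuation t < 1) (ha : ∀ V ∈ Y, Absorbs V t) :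
    IsGDomain (A Y) := by
  have htA : t ∈ A Y := mem_A.2 fun V hV => by
    rcases ht V hV with rfl | htV
    exacts [trivial, mem_of_lt_one htV]
  refine (isGDomain_iff _).2 ⟨⟨t, htA⟩, fun h => ht0 (congrArg Subtype.val h), fun P hP hP0 => ?_⟩
  obtain ⟨p, hp, hp0⟩ := (Submodule.ne_bot_iff P).1 hP0
  obtain ⟨n, hn⟩ := exists_pow_mul_mem hY ht ha (p : F)⁻¹
  have hp0' : (p : F) ≠ 0 := fun h => hp0 (Subtype.ext h)
  have e : (⟨t, htA⟩ : A Y) ^ n = ⟨_, mem_A.2 (hn n le_rfl)⟩ * p := Subtype.ext (by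
    change t ^ n = t ^ n * (p : F)⁻¹ * p
    field_simp)
  exact hP.mem_of_pow_mem n (e ▸ P.mul_mem_left _ hp)

/-- If `R` has invertible pairs, so has `A Y`, provided that the members of `Y` not containing `R`
have rank one. -/
theorem hasInvertiblePairs_A {R : Subring F} (hR : HasInvertiblePairs R) (ht0 : t ≠ 0)
    (hY : IsUltraClosed Y) (ht : ∀ V ∈ Y, V = ⊤ ∨ V.valuation t < 1)
    (ha : ∀ V ∈ Y, Absorbs V t) (hYR : ∀ V ∈ Y, R ≤ V.toSubring ∨ IsRankOne V) :
    HasInvertiblePairs (A Y) := by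
  classical
  intro w
  rcases eq_or_ne w 0 with rfl | hw0
  · exact ⟨1, 0, by simp [(A Y).zero_mem, (A Y).one_mem]⟩
  obtain ⟨a, b, h₁, h₂, h₃, h₄, h₅⟩ := hR w
  let S : Finset F := {a, b, a * w, b * w}
  have hSR : ∀ f ∈ S, f ∈ R := by
    simp only [S, Finset.mem_insert, Finset.mem_singleton]
    rintro f (rfl | rfl | rfl | rfl) <;> assumption
  have pole : ∀ V : ValuationSubring F, IsRankOne V → ∀ f ∉ V, Absorbs V f⁻¹ := by
    intro V hV f hf
    have hf0 : f ≠ 0 := fun h => hf (h ▸ V.zero_mem)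
    exact hV.absorbs ((inv_notMem_iff V (inv_ne_zero hf0)).1 (by rwa [inv_inv]))
  let C : Set (ValuationSubring F) := {V | V ∈ Y ∧ ∃ f ∈ S, f ∉ V}
  have hC1 : ∀ V ∈ C, IsRankOne V := by
    rintro V ⟨hV, f, hf, hfV⟩
    exact (hYR V hV).resolve_left fun h => hfV (h (hSR f hf))
  obtain ⟨k, hk⟩ := exists_pow_mul_mem_finset hY ht ha {1, w, w⁻¹}
  simp only [Finset.mem_insert, Finset.mem_singleton, forall_eq_or_imp, forall_eq] at hk
  obtain ⟨hk₁, hk₂, hk₃⟩ := hk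
  -- On C the pair (1 - e₀, e₀w⁻¹) is a solution: 1 - e₀ cancels the poles of w, and e₀ those of w⁻¹
  -- where w ∈ V.
  obtain ⟨e₀, he₀⟩ := exists_approx_idempotent (hY.sep_notMem S) ht0 (fun V hV => ht V hV.1) w
    (fun V hV hf => pole V (hC1 V hV) w hf) k
  have scale : ∀ {V : ValuationSubring F} {n : ℕ} {x c : F},
      x / t ^ n ∈ V → t ^ n * c ∈ V → x * c ∈ V := by
    intro V n x c hx hc
    have := mul_mem hx hc
    rwa [← mul_assoc, div_mul_cancel₀ _ (pow_ne_zero n ht0)] at this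
  have hc : ∀ V ∈ C, 1 - e₀ ∈ V ∧ e₀ * w⁻¹ ∈ V ∧ (1 - e₀) * w ∈ V ∧ e₀ * w⁻¹ * w ∈ V := by
    intro V hV
    rw [inv_mul_cancel_right₀ hw0]
    obtain ⟨p₁, p₂⟩ := he₀ V hV
    by_cases hw : w ∈ V
    · have q := p₂ hw
      have e0 : e₀ ∈ V := by simpa using scale q (hk₁ V hV.1)
      have e1 := sub_mem V.one_mem e0
      exact ⟨e1, scale q (hk₃ V hV.1), mul_mem e1 hw, e0⟩
    · have q := p₁ hw
      have e1 : 1 - e₀ ∈ V := by simpa using scale q (hk₁ V hV.1)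
      have e0 : e₀ ∈ V := by simpa using sub_mem V.one_mem e1
      exact ⟨e1, mul_mem e0 ((V.mem_or_inv_mem w).resolve_left hw), scale q (hk₂ V hV.1), e0⟩
  let T : Finset F := {1 - e₀, e₀ * w⁻¹, (1 - e₀) * w, e₀ * w⁻¹ * w}
  obtain ⟨n, hn⟩ := exists_pow_mul_mem_finset hY ht ha ({1} ∪ (S ∪ T))
  obtain ⟨e, he⟩ := exists_approx_idempotent_finset hY ht0 ht S
    (fun f hf V hV hfV => pole V (hC1 V ⟨hV, f, hf, hfV⟩) f hfV) n
  -- On C the factor 1 - e cancels the poles of x; off C the factor e cancels those of y.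
  have glue : ∀ x y : F, x ∈ S → y ∈ T → (∀ V ∈ C, y ∈ V) → (1 - e) * x + e * y ∈ A Y := by
    refine fun x y hx hy hyC => mem_A.2 fun V hV => ?_
    obtain ⟨p₁, p₂⟩ := he V hV
    have n1 := hn 1 (by simp) V hV
    have nx := hn x (by simp [hx]) V hV
    have ny := hn y (by simp [hy]) V hV
    by_cases hVC : ∃ f ∈ S, f ∉ V
    · have q := p₁ hVC
      have e1 : 1 - e ∈ V := by simpa using scale q n1
      have e0 : e ∈ V := by simpa using sub_mem V.one_mem e1
      exact add_mem (scale q nx) (mul_mem e0 (hyC V ⟨hV, hVC⟩))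
    · push Not at hVC
      have q := p₂ hVC
      have e0 : e ∈ V := by simpa using scale q n1
      exact add_mem (mul_mem (sub_mem V.one_mem e0) (hVC x hx)) (scale q ny)
  refine ⟨(1 - e) * a + e * (1 - e₀), (1 - e) * b + e * (e₀ * w⁻¹), ?_, ?_, ?_, ?_, ?_⟩
  · exact glue _ _ (by simp [S]) (by simp [T]) fun V hV => (hc V hV).1
  · exact glue _ _ (by simp [S]) (by simp [T]) fun V hV => (hc V hV).2.1
  · rw [add_mul, mul_assoc, mul_assoc]
    exact glue _ _ (by simp [S]) (by simp [T]) fun V hV => (hc V hV).2.2.1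
  · rw [add_mul, mul_assoc, mul_assoc e]
    exact glue _ _ (by simp [S]) (by simp [T]) fun V hV => (hc V hV).2.2.2
  · have : e₀ * w⁻¹ * w = e₀ := inv_mul_cancel_right₀ hw0 e₀
    linear_combination (1 - e) * h₅ + e * this

end Closed

/-! ### A common small element -/

/-- The element `h / (h ^ 2 + 1)` is small where `h` is small. -/
theorem exists_mem_div_sq_add_one_eq {V : ValuationSubring F} {h : F} (hV : V.valuation h < 1) :
    ∃ u ∈ V, h / (h ^ 2 + 1) = h * u :=
  ⟨(1 + h ^ 2)⁻¹, inv_one_add_mem V (by rw [sq]; exact lt_one_mul_mem hV (mem_of_lt_one hV)),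
    by rw [add_comm, div_eq_mul_inv]⟩

theorem div_sq_add_one_inv {h : F} (hh : h ≠ 0) : h⁻¹ / (h⁻¹ ^ 2 + 1) = h / (h ^ 2 + 1) := by
  have : h⁻¹ ^ 2 + 1 = (h ^ 2 + 1) / h ^ 2 := by field_simp; ring
  rw [this, div_div_eq_mul_div]
  congr 1
  field_simp

theorem valuation_div_sq_add_one_lt_one {V : ValuationSubring F} {h : F} (hh : h ≠ 0)
    (hV : V.valuation h < 1 ∨ V.valuation h⁻¹ < 1) : V.valuation (h / (h ^ 2 + 1)) < 1 := by
  rcases hV with hV | hV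
  · obtain ⟨u, hu, e⟩ := exists_mem_div_sq_add_one_eq hV
    exact e ▸ lt_one_mul_mem hV hu
  · obtain ⟨u, hu, e⟩ := exists_mem_div_sq_add_one_eq hV
    rw [← div_sq_add_one_inv hh, e]
    exact lt_one_mul_mem hV hu

theorem sq_add_one_ne_zero_of_valuation {V : ValuationSubring F} {h : F}
    (hV : V.valuation h < 1 ∨ V.valuation h⁻¹ < 1) : h ^ 2 + 1 ≠ 0 := by
  intro h0
  have hh : h ≠ 0 := by
    rintro rfl
    simp at h0
  have hi : h⁻¹ = -h := inv_eq_of_mul_eq_one_right (by linear_combination -h0)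
  rw [hi, Valuation.map_neg, or_self] at hV
  have := lt_one_mul_mem hV (y := h⁻¹) (hi ▸ neg_mem (mem_of_lt_one hV))
  rw [mul_inv_cancel₀ hh, map_one] at this
  exact lt_irrefl _ this

theorem Absorbs.mul_right {V : ValuationSubring F} {x u : F} (hx : Absorbs V x) (hu : u ∈ V) :
    Absorbs V (x * u) := fun c => by
  obtain ⟨n, hn⟩ := hx c
  refine ⟨n, ?_⟩
  have e : (x * u) ^ n * c = x ^ n * c * u ^ n := by ring
  rw [e]
  exact mul_mem hn (pow_mem hu n)

theorem absorbs_top (x : F) : Absorbs ⊤ x := fun _ => ⟨0, trivial⟩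

/-- From an element that is small on `X` and one that is small on the valuation overrings of `R`,
we obtain a single element that is small on both. -/
theorem exists_common_small {X : Set (ValuationSubring F)} (hX : X.Nonempty)
    (hrank : ∀ V ∈ X, IsRankOne V) {R : Subring F}
    (hY : IsUltraClosed (X ∪ {V : ValuationSubring F | R ≤ V.toSubring})) {j : F} (hj0 : j ≠ 0)
    (hj : j ∈ J X) (hR : IsFractionRing R F) (hG : IsGDomain R) :
    ∃ t : F, t ≠ 0 ∧
      (∀ V ∈ X ∪ {V : ValuationSubring F | R ≤ V.toSubring}, V = ⊤ ∨ V.valuation t < 1) ∧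
      ∀ V ∈ X ∪ {V : ValuationSubring F | R ≤ V.toSubring}, Absorbs V t := by
  obtain ⟨g, hg0, hg⟩ := (isGDomain_iff R).1 hG
  have hg0' : (g : F) ≠ 0 := fun h => hg0 (Subtype.ext h)
  have hjV := mem_J.1 hj
  have hD := hY.sep_notMem {(g : F)⁻¹}
  simp only [Finset.mem_singleton, exists_eq_left, inv_notMem_iff _ hg0'] at hD
  have hgA : ∀ V ∈ X ∪ {V : ValuationSubring F | R ≤ V.toSubring}, V.valuation (g : F) < 1 →
      Absorbs V (g : F) := by
    rintro V (hV | hV) hgV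
    exacts [(hrank V hV).absorbs hgV, absorbs_of_mem_primes_of_le hV hR hg]
  obtain ⟨N, hN⟩ := exists_pow_mul_mem hD (fun V hV => Or.inr hV.2)
    (fun V hV => hgA V hV.1 hV.2) j⁻¹
  replace hN := hN N le_rfl
  -- Thus h = g ^ (N + 1) / j is small where g is; at the other members of X its inverse is small
  -- because j is. The expression h / (h ^ 2 + 1), symmetric in h and h⁻¹, is small in both cases.
  set h : F := g * ((g : F) ^ N * j⁻¹) with hh
  have hh0 : h ≠ 0 := mul_ne_zero hg0' (mul_ne_zero (pow_ne_zero N hg0') (inv_ne_zero hj0))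
  have hsmall : ∀ V ∈ X ∪ {V : ValuationSubring F | R ≤ V.toSubring}, V.valuation (g : F) < 1 →
      V.valuation h < 1 := fun V hV hgV => lt_one_mul_mem hgV (hN V ⟨hV, hgV⟩)
  have hXh : ∀ V ∈ X, V.valuation h < 1 ∨ V.valuation h⁻¹ < 1 := by
    intro V hV
    by_cases hgV : V.valuation (g : F) < 1
    · exact Or.inl (hsmall V (Or.inl hV) hgV)
    · have hgi : (g : F)⁻¹ ∈ V := by
        rwa [← inv_notMem_iff V hg0', not_not] at hgV
      have e : h⁻¹ = j * (g : F)⁻¹ ^ (N + 1) := by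
        rw [hh, inv_pow, pow_succ']; field_simp
      rw [e]
      exact Or.inr (lt_one_mul_mem (hjV V hV) (pow_mem hgi _))
  obtain ⟨V₀, hV₀⟩ := hX
  have ht : ∀ V ∈ X ∪ {V : ValuationSubring F | R ≤ V.toSubring},
      V = ⊤ ∨ V.valuation (h / (h ^ 2 + 1)) < 1 := by
    rintro V (hV | hV)
    · exact Or.inr (valuation_div_sq_add_one_lt_one hh0 (hXh V hV))
    · refine or_iff_not_imp_left.2 fun htop => valuation_div_sq_add_one_lt_one hh0 (Or.inl ?_)
      exact hsmall V (Or.inr hV) (valuation_lt_one_of_mem_primes hV hR hg htop)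
  -- A member of X is needed to exclude h ^ 2 = -1.
  refine ⟨h / (h ^ 2 + 1), div_ne_zero hh0 (sq_add_one_ne_zero_of_valuation (hXh V₀ hV₀)), ht, ?_⟩
  rintro V (hV | hV)
  · exact (hrank V hV).absorbs ((ht V (Or.inl hV)).resolve_left (hrank V hV).ne_top)
  · rcases eq_or_ne V ⊤ with rfl | htop
    · exact absorbs_top _
    have hgV := valuation_lt_one_of_mem_primes hV hR hg htop
    obtain ⟨u, hu, e⟩ := exists_mem_div_sq_add_one_eq (hsmall V (Or.inr hV) hgV)
    rw [e]
    exact ((hgA V (Or.inr hV) hgV).mul_right (hN V ⟨Or.inr hV, hgV⟩)).mul_right hu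

end

end ZariskiRiemann

theorem theorem4p3 {F : Type*} [Field F] (X₁ X₂ : Set (ValuationSubring F))
    (hX₁ : X₁.Nonempty) (hrank : ∀ V ∈ X₁, ZariskiRiemann.IsRankOne V)
    (hlim : ZariskiRiemann.lim X₁ ⊆ X₂) :
    (ZariskiRiemann.J X₁ ≠ {0} ∧
        ZariskiRiemann.IsPruferGDomainWithQuotientField (ZariskiRiemann.A X₂)) ↔
      ZariskiRiemann.IsPruferGDomainWithQuotientField
        (ZariskiRiemann.A X₁ ⊓ ZariskiRiemann.A X₂) := by
  open ZariskiRiemann in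
  constructor
  · rintro ⟨hJ, hP, hG, hR⟩
    obtain ⟨j, hj0, hj⟩ := J_ne_zero_iff.1 hJ
    -- X₂ itself need not be closed; all valuation overrings of A(X₂) are used instead, with the
    -- same intersection.
    have hY : IsUltraClosed (X₁ ∪ {V : ValuationSubring F | A X₂ ≤ V.toSubring}) :=
      isUltraClosed_union fun V hV x hx => mem_A.1 hx V (hlim hV)
    obtain ⟨t, ht0, ht, ha⟩ := exists_common_small hX₁ hrank hY hj0 hj hR hG
    have e : A X₁ ⊓ A X₂ = A (X₁ ∪ {V : ValuationSubring F | A X₂ ≤ V.toSubring}) := by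
      ext x
      rw [Subring.mem_inf, mem_A, mem_A (X := X₁ ∪ _)]
      constructor
      · rintro ⟨h₁, h₂⟩ V (hV | hV)
        exacts [h₁ V hV, hV h₂]
      · exact fun h => ⟨fun V hV => h V (Or.inl hV),
          mem_A.2 fun V hV => h V (Or.inr fun y hy => mem_A.1 hy V hV)⟩
    rw [e]
    exact ⟨(hasInvertiblePairs_A (hP.hasInvertiblePairs hR) ht0 hY ht ha
      fun V hV => hV.elim (fun h => Or.inr (hrank V h)) Or.inl).isPruferDomain,
      isGDomain_A ht0 hY ht ha, isFractionRing_A ht0 hY ht ha⟩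
  · intro h
    refine ⟨?_, h.mono inf_le_right⟩
    obtain ⟨_, hG, hR⟩ := h
    obtain ⟨g, hg0, hg⟩ := (isGDomain_iff _).1 hG
    refine J_ne_zero_iff.2 ⟨g, fun h => hg0 (Subtype.ext h), mem_J.2 fun V hV => ?_⟩
    exact valuation_lt_one_of_mem_primes (fun x hx => mem_A.1 (Subring.mem_inf.1 hx).1 V hV) hR hg
      (hrank V hV).ne_top
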